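/- **Setting.** Let $p=p(\rho,e)$ be any equation of state such that, for $\rho>0$, $e>0\Leftrightarrow p(\rho,e)>0$. For ${\bf U}=(\rho,{\bf m},{\bf B},E)\in\mathbb R^8$ (with ${\bf m},{\bf B}\in\mathbb R^3$) put ${\bf v}={\bf m}/\rho$, $\mathcal E({\bf U})=E-\frac12\big(|{\bf m}|^2/\rho+|{\bf B}|^2\big)$, $e=\mathcal E({\bf U})/\rho$, $p=p(\rho,e)$, $p_{tot}=p+\frac12|{\bf B}|^2$, and let $$\mathcal G=\{{\bf U}:\rho>0,\ \mathcal E({\bf U})>0\}$$ be the set of admissible states of ideal MHD. Let $${\bf F}_1({\bf U})=\big(\rho v_1,\ \rho v_1{\bf v}-B_1{\bf B}+p_{tot}{\bf e}_1,\ v_1{\bf B}-B_1{\bf v},\ v_1(E+p_{tot})-B_1({\bf v}\cdot{\bf B})\big),$$ and, for a viscosity parameter $\alpha$, let $\hat{\bf F}_1({\bf U}^-,{\bf U}^+)=\frac12\big({\bf F}_1({\bf U}^-)+{\bf F}_1({\bf U}^+)-\alpha({\bf U}^+-{\bf U}^-)\big)$ be the Lax–Friedrichs flux. Put $\mathscr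 C_s=\frac{p}{\rho\sqrt{2e}}$, $$\mathscr C_1=\tfrac1{\sqrt2}\Big[\mathscr C_s^2+\tfrac{|{\bf B}|^2}{\rho}+\sqrt{\big(\mathscr C_s^2+\tfrac{|{\bf B}|^2}{\rho}\big)^2-4\tfrac{\mathscr C_s^2B_1^2}{\rho}}\Big]^{1/2},$$ and, for two states ${\bf U},\tilde{\bf U}$, $\alpha_1({\bf U},\tilde{\bf U})=\min_{\sigma\in\mathbb R}\alpha_1({\bf U},\tilde{\bf U};\sigma)$ with $$\alpha_1({\bf U},\tilde{\bf U};\sigma)=\max\big\{|v_1|+\mathscr C_1,\ |\tilde v_1|+\tilde{\mathscr C}_1,\ |\sigma v_1+(1-\sigma)\tilde v_1|+\max\{\mathscr C_1,\tilde{\mathscr C}_1\}\big\}+\tfrac{|\tilde{\bf B}-{\bf B}|}{\sqrt2}\sqrt{\tfrac{\sigma^2}{\rho}+\tfrac{(1-\sigma)^2}{\tilde\rho}} .$$ **Scheme.** Let $I_j=(x_{j-1/2},x_{j+1/2})$, $j\in\mathbb Z$, be uniform cells of length $\Delta x>0$. Let $K\ge1$ and $L$ be integers with $2L-3\ge K$;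 let $\hat x_j^{(1)}=x_{j-1/2}<\dots<\hat x_j^{(L)}=x_{j+1/2}$ be the $L$-point Gauss–Lobatto nodes in $I_j$ and $\hat\omega_1,\dots,\hat\omega_L$ the corresponding weights, normalized by $\sum_\mu\hat\omega_\mu=1$. At every time level $n\ge 0$ let ${\bf U}^n_j(x)$, $j\in\mathbb Z$, be vectors of polynomials of degree at most $K$ with cell average $\bar{\bf U}^n_j=\frac1{\Delta x}\int_{I_j}{\bf U}_j^n(x)\,dx$, put ${\bf U}^-_{j+1/2}={\bf U}^n_j(x_{j+1/2})$, ${\bf U}^+_{j+1/2}={\bf U}^n_{j+1}(x_{j+1/2})$, and suppose that the cell averages obey the finite volume / discontinuous Galerkin scheme with viscosity parameter $\alpha_n$ and time step $\Delta t_n$, $$\bar{\bf U}_j^{n+1}=\bar{\bf U}_j^n-\frac{\Delta t_n}{\Delta x}\Big(\hat{\bf F}_1({\bf U}^-_{j+1/2},{\bf U}^+_{j+1/2})-\hat{\bf F}_1({\bf U}^-_{j-1/2},{\bf U}^+_{j-1/2})\Big).$$ **Theorem.** Let ${\tt B}_{\tt const}\in\mathbb R$, and consider the following conditions at a time level $n$: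 1. $B^{-}_{1,j+1/2}=B^{+}_{1,j+1/2}={\tt B}_{\tt const}$ for all $j$; 2. ${\bf U}^n_j(\hat x_j^{(\mu)})\in\mathcal G$ for all $j$ and all $\mu=1,\dots,L$; 3. $\alpha_n>\alpha_1({\bf U}^-_{j+1/2},{\bf U}^-_{j-1/2})$ and $\alpha_n>\alpha_1({\bf U}^+_{j+1/2},{\bf U}^+_{j-1/2})$ for all $j$; 4. $0<\alpha_n\Delta t_n/\Delta x\le\hat\omega_1$. If they hold at time level $n$, then $\bar{\bf U}_j^{n+1}\in\mathcal G$ for all $j$. Consequently the scheme is positivity-preserving: if $\bar{\bf U}^0_j\in\mathcal G$ for all $j$ and the conditions hold at all levels $n<N$, then $\bar{\bf U}^n_j\in\mathcal G$ for all $j$ and all $n\le N$. -/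

import Mathlib

open scoped Polynomial

noncomputable section

namespace MHD

/-! ### States, admissible states, flux -/

/-- Conservative vectors `U = (ρ, m, B, E)` of ideal MHD: component `0` is the density `ρ`,
components `1, 2, 3` are the momentum `m = ρ v`, components `4, 5, 6` are the magnetic
field `B`, component `7` is the total energy `E`. -/
abbrev State : Type := Fin 8 → ℝ

/-- Density `ρ`. -/
def rho (U : State) : ℝ := U 0

/-- Momentum vector `m`. -/
def mom (U : State) : Fin 3 → ℝ := ![U 1, U 2, U 3]

/-- Magnetic field `B = (B₁, B₂, B₃)` (indexed by `0, 1, 2`). -/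
def mag (U : State) : Fin 3 → ℝ := ![U 4, U 5, U 6]

/-- Total energy `E`. -/
def totalEnergy (U : State) : ℝ := U 7

/-- Velocity `v = m / ρ`. -/
def vel (U : State) : Fin 3 → ℝ := fun i => mom U i / rho U

/-- Squared Euclidean length `|w|²` of a vector of `ℝ³`. -/
def sqNorm (w : Fin 3 → ℝ) : ℝ := ∑ i, w i ^ 2

/-- The internal energy `𝓔(U) = ρ e = E - (|m|² / ρ + |B|²) / 2`. -/
def internalEnergy (U : State) : ℝ :=
  totalEnergy U - (1 / 2) * (sqNorm (mom U) / rho U + sqNorm (mag U))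

/-- The set `𝓖` of admissible states. -/
def admissibleSet : Set State := {U | 0 < rho U ∧ 0 < internalEnergy U}

/-- Specific internal energy `e = 𝓔(U) / ρ`. -/
def specificEnergy (U : State) : ℝ := internalEnergy U / rho U

/-- The standing condition on an equation of state `p = p(ρ, e)`:
for `ρ > 0`, `e > 0` if and only if `p(ρ, e) > 0`. -/
def IsEOS (p : ℝ → ℝ → ℝ) : Prop := ∀ ρ e : ℝ, 0 < ρ → (0 < e ↔ 0 < p ρ e)

/-- Gas pressure of a state, for the equation of state `p`. -/
def pressure (p : ℝ → ℝ → ℝ) (U : State) : ℝ := p (rho U) (specificEnergy U)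

/-- Total pressure `p_tot = p + |B|² / 2`. -/
def totalPressure (p : ℝ → ℝ → ℝ) (U : State) : ℝ := pressure p U + sqNorm (mag U) / 2

/-- The flux in the `x₁`-direction,
`F₁(U) = (ρ v₁, ρ v₁ v - B₁ B + p_tot e₁, v₁ B - B₁ v, v₁ (E + p_tot) - B₁ (v · B))`. -/
def flux (p : ℝ → ℝ → ℝ) (U : State) : State :=
  let v := vel U
  let B := mag U
  let ptot := totalPressure p U
  ![rho U * v 0,
    rho U * v 0 * v 0 - B 0 * B 0 + ptot,
    rho U * v 0 * v 1 - B 0 * B 1,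
    rho U * v 0 * v 2 - B 0 * B 2,
    v 0 * B 0 - B 0 * v 0,
    v 0 * B 1 - B 0 * v 1,
    v 0 * B 2 - B 0 * v 2,
    v 0 * (totalEnergy U + ptot) - B 0 * (∑ i, v i * B i)]

/-- The Lax–Friedrichs flux with numerical viscosity parameter `α`:
`F̂₁(U⁻, U⁺) = (F₁(U⁻) + F₁(U⁺) - α (U⁺ - U⁻)) / 2`. -/
def lfFlux (p : ℝ → ℝ → ℝ) (α : ℝ) (Um Up : State) : State :=
  (1 / 2 : ℝ) • (flux p Um + flux p Up - α • (Up - Um))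

/-! ### The lower bound for the viscosity parameter -/

/-- `𝒞_s = p / (ρ √(2 e))`. -/
def soundLike (p : ℝ → ℝ → ℝ) (U : State) : ℝ :=
  pressure p U / (rho U * √(2 * specificEnergy U))

/-- `𝒞₁ = (1/√2) [𝒞_s² + |B|²/ρ + √((𝒞_s² + |B|²/ρ)² - 4 𝒞_s² B₁² / ρ)]^{1/2}`. -/
def fastLike (p : ℝ → ℝ → ℝ) (U : State) : ℝ :=
  1 / √2 * √(soundLike p U ^ 2 + sqNorm (mag U) / rho U
    + √((soundLike p U ^ 2 + sqNorm (mag U) / rho U) ^ 2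
        - 4 * (soundLike p U ^ 2 * mag U 0 ^ 2 / rho U)))

/-- `f(U, V; σ) = (|B_V - B_U| / √2) √(σ²/ρ_U + (1-σ)²/ρ_V)`. -/
def magJump (U V : State) (σ : ℝ) : ℝ :=
  √(sqNorm (mag V - mag U)) / √2 * √(σ ^ 2 / rho U + (1 - σ) ^ 2 / rho V)

/-- `α₁(U, V; σ)`. -/
def alphaAt (p : ℝ → ℝ → ℝ) (U V : State) (σ : ℝ) : ℝ :=
  max (max (|vel U 0| + fastLike p U) (|vel V 0| + fastLike p V))
      (|σ * vel U 0 + (1 - σ) * vel V 0| + max (fastLike p U) (fastLike p V))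
    + magJump U V σ

/-- `α₁(U, V) = min_{σ ∈ ℝ} α₁(U, V; σ)`. The function `σ ↦ α₁(U, V; σ)` is nonnegative, so the
infimum is a genuine one; for positive densities it is attained. -/
def alphaOne (p : ℝ → ℝ → ℝ) (U V : State) : ℝ := ⨅ σ : ℝ, alphaAt p U V σ

/-! ### Gauss–Lobatto quadrature -/

/-- The nodes of the `L`-point Gauss–Lobatto rule (`L ≥ 2`) on the reference interval `[0, 1]`:
the two endpoints and the zeros of the derivative of the Legendre polynomial of degree `L - 1`
(Mathlib's `shiftedLegendre` is the Legendre polynomial transported from `[-1, 1]` to `[0, 1]`). -/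
def lobattoNodes (L : ℕ) : Finset ℝ :=
  (Polynomial.X * (1 - Polynomial.X) * Polynomial.derivative
    ((Polynomial.shiftedLegendre (L - 1)).map (Int.castRingHom ℝ)) : ℝ[X]).roots.toFinset

/-- The weight associated with the node `ξ` on the unit interval: the integral of the Lagrange basis
polynomial of `ξ`. The weights are thus normalized to have sum `1`. -/
def lobattoWeight (L : ℕ) (ξ : ℝ) : ℝ :=
  ∫ x in (0 : ℝ)..1, (Lagrange.basis (lobattoNodes L) id ξ).eval x

/-! ### Mesh, piecewise polynomials and the scheme -/

/-- A vector of eight real polynomials in the space variable. -/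
abbrev PolyState : Type := Fin 8 → ℝ[X]

/-- Value of a polynomial vector at a point. -/
def PolyState.at (P : PolyState) (x : ℝ) : State := fun i => (P i).eval x

/-- Left endpoint `x_{j-1/2} = x₀ + j Δx` of the `j`-th cell `I_j = (x_{j-1/2}, x_{j+1/2})` of a
uniform mesh; the right endpoint is `face x₀ dx (j + 1)`. -/
def face (x₀ dx : ℝ) (j : ℤ) : ℝ := x₀ + j * dx

/-- Average of the polynomial vector `P` over the cell `I_j`. -/
def cellAverage (x₀ dx : ℝ) (j : ℤ) (P : PolyState) : State := fun i =>
  (1 / dx) * ∫ x in (face x₀ dx j)..(face x₀ dx (j + 1)), (P i).eval x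

/-- `U⁻_{j+1/2} = U_j(x_{j+1/2} - 0)`: the trace at the right end of cell `I_j` from within `I_j`
(a polynomial is continuous, so its one-sided limit is its value). -/
def traceMinus (x₀ dx : ℝ) (P : ℤ → PolyState) (j : ℤ) : State :=
  (P j).at (face x₀ dx (j + 1))

/-- `U⁺_{j+1/2} = U_{j+1}(x_{j+1/2} + 0)`: the trace at the same point from within `I_{j+1}`. -/
def tracePlus (x₀ dx : ℝ) (P : ℤ → PolyState) (j : ℤ) : State :=
  (P (j + 1)).at (face x₀ dx (j + 1))

/-- Right-hand side of the scheme for the cell averages in the cell `I_j`: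
`Ū_j - (Δt/Δx) (F̂₁(U⁻_{j+1/2}, U⁺_{j+1/2}) - F̂₁(U⁻_{j-1/2}, U⁺_{j-1/2}))`. -/
def schemeUpdate (p : ℝ → ℝ → ℝ) (x₀ dx dt α : ℝ) (Ubar : ℤ → State) (P : ℤ → PolyState)
    (j : ℤ) : State :=
  Ubar j - (dt / dx) •
    (lfFlux p α (traceMinus x₀ dx P j) (tracePlus x₀ dx P j)
      - lfFlux p α (traceMinus x₀ dx P (j - 1)) (tracePlus x₀ dx P (j - 1)))

/-- The conditions imposed at one time level on the polynomial vectors `P j = U_jⁿ`, on the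
viscosity parameter `α` and on the time step `dt`. -/
structure LevelConditions (p : ℝ → ℝ → ℝ) (L : ℕ) (x₀ dx Bconst : ℝ) (P : ℤ → PolyState)
    (α dt : ℝ) : Prop where
  /-- `B₁` equals the given constant on both sides of every interface. -/
  mag_const : ∀ j, mag (traceMinus x₀ dx P j) 0 = Bconst ∧ mag (tracePlus x₀ dx P j) 0 = Bconst
  /-- The values at all Gauss–Lobatto nodes of all cells are admissible. -/
  nodes_admissible : ∀ j, ∀ ξ ∈ lobattoNodes L, (P j).at (face x₀ dx j + dx * ξ) ∈ admissibleSet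
  /-- `α > α₁(U^±_{j+1/2}, U^±_{j-1/2})` for all `j` and both signs. -/
  viscosity : ∀ j,
    alphaOne p (traceMinus x₀ dx P j) (traceMinus x₀ dx P (j - 1)) < α ∧
    alphaOne p (tracePlus x₀ dx P j) (tracePlus x₀ dx P (j - 1)) < α
  /-- The CFL condition `0 < α Δt / Δx ≤ ω̂₁`, where `ω̂₁` is the weight of the left endpoint. -/
  cfl : 0 < α * dt / dx ∧ α * dt / dx ≤ lobattoWeight L 0

end MHD

end

open scoped Polynomial

noncomputable section

namespace MHD

section Quadrature

open Polynomial intervalIntegral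

/-! ### Integrals of polynomials over the unit interval -/

/-! Positivity of `internalEnergy` is nonlinear, but for positive density it holds exactly when the
affine functionals `relEnergy a b` are positive for all `a`, `b` (`mem_admissibleSet_iff`). Hence
the admissible set is convex.

Regrouping the fluxes by trace side gives Ū + c(Ξ⁺ - U⁺_{j-1/2}) + c(Ξ⁻ - U⁻_{j+1/2}), where c =
αΔt/Δx and Ξ^± is the `lfAverage` of the two traces of one side (`schemeUpdate_eq`). Gauss–Lobatto
quadrature writes Ū as a convex combination of node values in which both subtracted traces carry the
weight ω̂₁. As c ≤ ω̂₁, the update is a convex combination of node values, Ξ⁺ and Ξ⁻. This needs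
exactness, positivity and symmetry of the rule, all drawn from orthogonality of Legendre
polynomials.

It remains that Ξ^± is admissible (`lfAverage_mem`). Tested with `relEnergy`, the flux splits into
transport by v₁, a coupling bounded by `fastLike` through a quadratic form (`abs_coupling_le`), a
term a₁|B-b|²/2, and a remainder depending on the state only through B₁. The remainders of two
states with equal B₁ cancel. The a₁ terms are compared with σv₁ + (1-σ)ṽ₁, at the cost `magJump`
(`abs_cross_le`). -/

lemma intervalIntegrable_eval (f : ℝ[X]) (a b : ℝ) :
    IntervalIntegrable (fun x => f.eval x) MeasureTheory.volume a b :=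
  f.continuous.intervalIntegrable a b

lemma integral_eval_pos {f : ℝ[X]} (hf : f ≠ 0) (h0 : ∀ x ∈ Set.Icc (0 : ℝ) 1, 0 ≤ f.eval x) :
    0 < ∫ x in (0 : ℝ)..1, f.eval x := by
  obtain ⟨c, hc, hc'⟩ : ∃ c ∈ Set.Icc (0 : ℝ) 1, f.eval c ≠ 0 := by
    by_contra! h
    exact hf (f.eq_zero_of_infinite_isRoot
      ((Set.Icc_infinite (zero_lt_one' ℝ)).mono fun x hx => h x hx))
  exact integral_pos one_pos f.continuous.continuousOn
    (fun x hx => h0 x ⟨hx.1.le, hx.2⟩) ⟨c, hc, lt_of_le_of_ne (h0 c hc) hc'.symm⟩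

lemma integral_derivative_mul {u : ℝ[X]} (h0 : u.eval 0 = 0) (h1 : u.eval 1 = 0) (r : ℝ[X]) :
    ∫ x in (0 : ℝ)..1, (derivative u * r).eval x
      = -∫ x in (0 : ℝ)..1, (u * derivative r).eval x := by
  have h := integral_mul_deriv_eq_deriv_mul (a := 0) (b := 1)
    (fun x _ => r.hasDerivAt x) (fun x _ => u.hasDerivAt x)
    (intervalIntegrable_eval _ _ _) (intervalIntegrable_eval _ _ _)
  simp only [h0, h1, mul_zero, sub_zero, zero_sub] at h
  simpa only [eval_mul, mul_comm] using h

/-- Integration by parts k times: the zeros of order k at 0 and 1 lose one order per derivative, so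
every boundary term vanishes. -/
lemma integral_iterate_derivative_mul (k : ℕ) (u r : ℝ[X]) (h : (X * (1 - X)) ^ k ∣ u) :
    ∫ x in (0 : ℝ)..1, (derivative^[k] u * r).eval x
      = (-1) ^ k * ∫ x in (0 : ℝ)..1, (u * derivative^[k] r).eval x := by
  induction k generalizing u with
  | zero => simp
  | succ k ih =>
    have hd : (X * (1 - X)) ^ k ∣ derivative u := by
      simpa using pow_sub_one_dvd_derivative_of_pow_dvd h
    obtain ⟨s, rfl⟩ := h
    rw [Function.iterate_succ_apply, ih _ hd, integral_derivative_mul (by simp) (by simp),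
      Function.iterate_succ_apply']
    ring

/-! ### Legendre polynomials on the unit interval -/

/-- The shifted Legendre polynomial with real coefficients. -/
abbrev legendre (n : ℕ) : ℝ[X] := (shiftedLegendre n).map (Int.castRingHom ℝ)

lemma rodrigues (n : ℕ) :
    derivative^[n] ((X * (1 - X)) ^ n : ℝ[X]) = C (n.factorial : ℝ) * legendre n := by
  have h := congrArg (Polynomial.map (Int.castRingHom ℝ)) (factorial_mul_shiftedLegendre_eq n)
  simp only [Polynomial.map_mul, Polynomial.map_natCast, ← iterate_derivative_map,
    Polynomial.map_pow, Polynomial.map_sub, map_X, Polynomial.map_one] at h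
  rw [mul_pow, ← h]
  simp

lemma integral_legendre_mul {n : ℕ} {r : ℝ[X]} (hr : r.natDegree < n) :
    ∫ x in (0 : ℝ)..1, (legendre n * r).eval x = 0 := by
  have h := integral_iterate_derivative_mul n _ r (dvd_refl _)
  rw [rodrigues, iterate_derivative_eq_zero hr] at h
  simp only [eval_mul, eval_C, mul_assoc, mul_zero, eval_zero, integral_const_mul,
    integral_zero] at h
  simpa [Nat.factorial_ne_zero] using h

lemma natDegree_legendre (n : ℕ) : (legendre n).natDegree = n := by
  rw [natDegree_map_eq_of_injective (RingHom.injective_int _), natDegree_shiftedLegendre]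

lemma natDegree_derivative_legendre (n : ℕ) : (derivative (legendre n)).natDegree = n - 1 := by
  rw [natDegree_derivative, natDegree_legendre]

lemma derivative_legendre_ne_zero {n : ℕ} (hn : 1 ≤ n) : derivative (legendre n) ≠ 0 := by
  intro h
  have := derivative_eq_zero.1 h
  rw [natDegree_legendre] at this
  omega

/-- Integration by parts moves the derivative onto X(1 - X)r, leaving degree less than n, to which
`legendre n` is orthogonal. -/
lemma integral_derivative_legendre_mul {n : ℕ} {r : ℝ[X]} (hr : r.natDegree + 1 < n) :
    ∫ x in (0 : ℝ)..1, (X * (1 - X) * derivative (legendre n) * r).eval x = 0 := by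
  have h := integral_derivative_mul (u := X * (1 - X) * r) (by simp) (by simp) (legendre n)
  have hdeg : (derivative (X * (1 - X) * r)).natDegree < n := by
    have h1 : (X * (1 - X) * r : ℝ[X]).natDegree ≤ 1 + 1 + r.natDegree := by
      refine natDegree_mul_le_of_le (natDegree_mul_le_of_le natDegree_X_le ?_) le_rfl
      exact (natDegree_sub_le _ _).trans (by simp)
    have := natDegree_derivative_le (X * (1 - X) * r)
    omega
  rw [mul_comm, integral_legendre_mul hdeg] at h
  rw [show X * (1 - X) * derivative (legendre n) * r
    = X * (1 - X) * r * derivative (legendre n) by ring]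
  linarith

/-- The polynomial of degree `n + 1` whose roots are the Lobatto nodes. -/
abbrev lobattoPoly (n : ℕ) : ℝ[X] := X * (1 - X) * derivative (legendre n)

lemma one_sub_X_ne_zero : (1 - X : ℝ[X]) ≠ 0 := by
  intro h
  simpa using congrArg (eval 0) h

/-- A factorization `Pₙ' = g s` with `deg s ≤ n - 2` forces `g` to change sign in `[0, 1]`. -/
lemma derivative_legendre_ne_mul_of_nonneg {n : ℕ} (hn : 1 ≤ n) {g s : ℝ[X]}
    (h : derivative (legendre n) = g * s) (hs : s.natDegree + 1 < n)
    (hg : ∀ x ∈ Set.Icc (0 : ℝ) 1, 0 ≤ g.eval x) : False := by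
  have h0 := derivative_legendre_ne_zero hn
  have hi := integral_derivative_legendre_mul hs
  -- Tested against s, the integrand x(1 - x)g s² is nonnegative and not zero, yet orthogonality
  -- makes its integral vanish.
  refine (integral_eval_pos ?_ fun x hx => ?_).ne' hi
  · refine mul_ne_zero (mul_ne_zero (mul_ne_zero X_ne_zero one_sub_X_ne_zero) h0) ?_
    rintro rfl
    exact h0 (by simp [h])
  · rw [h]
    have := hg x hx
    have h1 : 0 ≤ 1 - x := sub_nonneg.2 hx.2
    have h2 := hx.1
    simp only [eval_mul, eval_X, eval_sub, eval_one]
    rw [show x * (1 - x) * (eval x g * eval x s) * eval x s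
      = x * (1 - x) * eval x g * (eval x s) ^ 2 by ring]
    positivity

/-- A root outside the open interval would split off a linear factor of constant sign on [0, 1]. -/
lemma root_derivative_legendre_mem_Ioo {n : ℕ} (hn : 1 ≤ n) {a : ℝ}
    (ha : (derivative (legendre n)).IsRoot a) : a ∈ Set.Ioo (0 : ℝ) 1 := by
  obtain ⟨s, hs⟩ := dvd_iff_isRoot.2 ha
  have h0 := derivative_legendre_ne_zero hn
  have hs0 : s ≠ 0 := by rintro rfl; exact h0 (by simp [hs])
  have hd := natDegree_derivative_legendre n
  rw [hs, natDegree_mul (X_sub_C_ne_zero a) hs0, natDegree_X_sub_C] at hd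
  by_contra hmem
  rw [Set.mem_Ioo, not_and_or, not_lt, not_lt] at hmem
  rcases hmem with h | h
  · refine derivative_legendre_ne_mul_of_nonneg hn hs (by omega) fun x hx => ?_
    simp only [eval_sub, eval_X, eval_C]
    linarith [hx.1]
  · refine derivative_legendre_ne_mul_of_nonneg hn (g := C a - X) (s := -s)
      (by rw [hs]; ring) (by rw [natDegree_neg]; omega) fun x hx => ?_
    simp only [eval_sub, eval_X, eval_C]
    linarith [hx.2]

/-- A multiple root would split off a square. -/
lemma nodup_roots_derivative_legendre {n : ℕ} (hn : 1 ≤ n) :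
    (derivative (legendre n)).roots.Nodup := by
  have h0 := derivative_legendre_ne_zero hn
  rw [Multiset.nodup_iff_count_le_one]
  intro a
  rw [count_roots]
  by_contra! h
  obtain ⟨s, hs⟩ := (le_rootMultiplicity_iff h0).1 (Nat.succ_le_of_lt h)
  have hs0 : s ≠ 0 := by rintro rfl; exact h0 (by simp [hs])
  have hd := natDegree_derivative_legendre n
  rw [hs, natDegree_mul (pow_ne_zero _ (X_sub_C_ne_zero a)) hs0, natDegree_pow,
    natDegree_X_sub_C] at hd
  refine derivative_legendre_ne_mul_of_nonneg hn hs (by omega) fun x hx => ?_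
  rw [eval_pow]
  exact even_two.pow_nonneg _

/-- By Rolle, differentiation loses at most one real root, which matches the drop in degree. -/
lemma splits_derivative {f : ℝ[X]} (hf : f.Splits) : (derivative f).Splits := by
  rw [splits_iff_card_roots] at hf ⊢
  have h1 := card_roots_le_derivative f
  have h2 := card_roots' (derivative f)
  have h3 := natDegree_derivative_le f
  omega

lemma splits_iterate_derivative {f : ℝ[X]} (hf : f.Splits) (k : ℕ) :
    (derivative^[k] f).Splits := by
  induction k with
  | zero => exact hf
  | succ k ih => rw [Function.iterate_succ_apply']; exact splits_derivative ih

lemma card_roots_derivative_legendre (n : ℕ) :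
    (derivative (legendre n)).roots.card = n - 1 := by
  have hs : ((X * (1 - X)) ^ n : ℝ[X]).Splits := by
    refine ((Splits.X).mul (Splits.of_natDegree_le_one ?_)).pow n
    exact (natDegree_sub_le _ _).trans (by simp)
  have h := splits_derivative (splits_iterate_derivative hs n)
  rw [rodrigues, derivative_C_mul, splits_iff_card_roots,
    roots_C_mul _ (by exact_mod_cast n.factorial_ne_zero),
    natDegree_C_mul (by exact_mod_cast n.factorial_ne_zero), natDegree_derivative_legendre] at h
  exact h

/-! ### Gauss–Lobatto quadrature -/

lemma lobattoPoly_ne_zero {n : ℕ} (hn : 1 ≤ n) : lobattoPoly n ≠ 0 :=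
  mul_ne_zero (mul_ne_zero X_ne_zero one_sub_X_ne_zero) (derivative_legendre_ne_zero hn)

lemma natDegree_one_sub_X : (1 - X : ℝ[X]).natDegree = 1 := by
  rw [← natDegree_neg, neg_sub, ← C_1, natDegree_X_sub_C]

lemma natDegree_lobattoPoly {n : ℕ} (hn : 1 ≤ n) : (lobattoPoly n).natDegree = n + 1 := by
  rw [natDegree_mul (mul_ne_zero X_ne_zero one_sub_X_ne_zero) (derivative_legendre_ne_zero hn),
    natDegree_mul X_ne_zero one_sub_X_ne_zero, natDegree_X, natDegree_one_sub_X,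
    natDegree_derivative_legendre]
  omega

lemma mem_lobattoNodes {L : ℕ} (hL : 2 ≤ L) {ξ : ℝ} :
    ξ ∈ lobattoNodes L ↔ ξ = 0 ∨ ξ = 1 ∨ (derivative (legendre (L - 1))).IsRoot ξ := by
  rw [lobattoNodes, Multiset.mem_toFinset, mem_roots (lobattoPoly_ne_zero (by omega))]
  simp only [IsRoot.def, eval_mul, eval_X, eval_sub, eval_one, mul_eq_zero, or_assoc, sub_eq_zero,
    eq_comm (a := (1 : ℝ))]

lemma zero_mem_lobattoNodes {L : ℕ} (hL : 2 ≤ L) : (0 : ℝ) ∈ lobattoNodes L :=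
  (mem_lobattoNodes hL).2 (Or.inl rfl)

lemma one_mem_lobattoNodes {L : ℕ} (hL : 2 ≤ L) : (1 : ℝ) ∈ lobattoNodes L :=
  (mem_lobattoNodes hL).2 (Or.inr (Or.inl rfl))

lemma eval_lobattoPoly_of_mem {L : ℕ} (hL : 2 ≤ L) {ξ : ℝ} (h : ξ ∈ lobattoNodes L) :
    (lobattoPoly (L - 1)).eval ξ = 0 := by
  rcases (mem_lobattoNodes hL).1 h with rfl | rfl | h
  · simp
  · simp
  · rw [eval_mul, h.eq_zero, mul_zero]

lemma mem_Icc_of_mem_lobattoNodes {L : ℕ} (hL : 2 ≤ L) {ξ : ℝ} (h : ξ ∈ lobattoNodes L) :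
    ξ ∈ Set.Icc (0 : ℝ) 1 := by
  rcases (mem_lobattoNodes hL).1 h with rfl | rfl | h
  · simp
  · simp
  · exact Set.Ioo_subset_Icc_self (root_derivative_legendre_mem_Ioo (by omega) h)

lemma card_lobattoNodes {L : ℕ} (hL : 2 ≤ L) : (lobattoNodes L).card = L := by
  have hn : 1 ≤ L - 1 := by omega
  have h : lobattoNodes L
      = insert 0 (insert 1 (derivative (legendre (L - 1))).roots.toFinset) := by
    ext ξ
    rw [mem_lobattoNodes hL]
    simp [mem_roots (derivative_legendre_ne_zero hn), -derivative_map]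
  have hr : ∀ a ∈ (derivative (legendre (L - 1))).roots.toFinset, a ∈ Set.Ioo (0 : ℝ) 1 :=
    fun a ha => root_derivative_legendre_mem_Ioo hn
      ((mem_roots (derivative_legendre_ne_zero hn)).1 (Multiset.mem_toFinset.1 ha))
  rw [h, Finset.card_insert_of_notMem, Finset.card_insert_of_notMem,
    Multiset.toFinset_card_of_nodup (nodup_roots_derivative_legendre hn),
    card_roots_derivative_legendre]
  · omega
  · exact fun h => lt_irrefl _ (hr 1 h).2
  · rw [Finset.mem_insert, not_or]
    exact ⟨zero_ne_one, fun h => lt_irrefl _ (hr 0 h).1⟩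

lemma integral_eval_eq_sum_of_degree_lt {L : ℕ} (hL : 2 ≤ L) {f : ℝ[X]} (hf : f.degree < L) :
    ∫ x in (0 : ℝ)..1, f.eval x = ∑ ξ ∈ lobattoNodes L, lobattoWeight L ξ * f.eval ξ := by
  have h := Lagrange.eq_interpolate (s := lobattoNodes L) (v := id) (Set.injOn_id _)
    (f := f) (by rwa [card_lobattoNodes hL])
  conv_lhs => rw [h]
  simp only [Lagrange.interpolate_apply, eval_finsetSum, eval_mul, eval_C, id]
  rw [integral_finsetSum fun ξ _ => (intervalIntegrable_eval _ _ _).const_mul _]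
  simp only [integral_const_mul, lobattoWeight]
  exact Finset.sum_congr rfl fun ξ _ => mul_comm _ _

/-- The `L`-point Gauss–Lobatto rule is exact for polynomials of degree at most `2 L - 3`. -/
lemma integral_eval_eq_sum {L : ℕ} (hL : 2 ≤ L) {f : ℝ[X]} (hf : f.natDegree + 3 ≤ 2 * L) :
    ∫ x in (0 : ℝ)..1, f.eval x = ∑ ξ ∈ lobattoNodes L, lobattoWeight L ξ * f.eval ξ := by
  by_cases hlt : f.natDegree < L
  · exact integral_eval_eq_sum_of_degree_lt hL
      (degree_le_natDegree.trans_lt (by exact_mod_cast hlt))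
  · have hn : 1 ≤ L - 1 := by omega
    have hN := natDegree_lobattoPoly hn
    have hN0 := lobattoPoly_ne_zero hn
    set N := lobattoPoly (L - 1) with hNdef
    -- The quotient has degree at most L - 3, so its product with N integrates to zero by
    -- orthogonality; that product also vanishes at the nodes. Only the remainder, of degree below
    -- L, counts.
    have hdiv : N * (f / N) + f % N = f := EuclideanDomain.div_add_mod f N
    have hmod : (f % N).degree < L := by
      refine (EuclideanDomain.mod_lt f hN0).trans_le ?_
      rw [degree_eq_natDegree hN0, hN]
      exact_mod_cast (by omega : L - 1 + 1 ≤ L)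
    have hq : (f / N).natDegree + 1 < L - 1 := by
      have hle : N.degree ≤ f.degree := by
        refine (natDegree_le_iff_degree_le.1 hN.le).trans
          (le_trans ?_ (degree_eq_natDegree (p := f) ?_).ge)
        · exact_mod_cast (by omega : L - 1 + 1 ≤ f.natDegree)
        · rintro rfl
          exact hlt (by simp; omega)
      have h := degree_add_div hN0 hle
      rw [← degree_mul] at h
      rcases eq_or_ne (f / N) 0 with h0 | h0
      · rw [h0, natDegree_zero]
        omega
      · have h' := natDegree_eq_of_degree_eq h
        rw [natDegree_mul hN0 h0, hN] at h'
        omega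
    have h1 : ∫ x in (0 : ℝ)..1, f.eval x = ∫ x in (0 : ℝ)..1, (f % N).eval x := by
      conv_lhs => rw [← hdiv]
      simp only [eval_add]
      rw [integral_add (intervalIntegrable_eval _ _ _) (intervalIntegrable_eval _ _ _),
        integral_derivative_legendre_mul hq, zero_add]
    rw [h1, integral_eval_eq_sum_of_degree_lt hL hmod]
    refine Finset.sum_congr rfl fun ξ hξ => ?_
    conv_rhs => rw [← hdiv]
    rw [eval_add, eval_mul, eval_lobattoPoly_of_mem hL hξ, zero_mul, zero_add]

lemma sum_lobattoWeight {L : ℕ} (hL : 2 ≤ L) : ∑ ξ ∈ lobattoNodes L, lobattoWeight L ξ = 1 := by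
  have h := integral_eval_eq_sum hL (f := 1) (by simp; omega)
  simpa using h.symm

/-! ### Positivity and symmetry of the Lobatto weights -/

lemma lobattoWeight_mul_eval {L : ℕ} (hL : 2 ≤ L) {f : ℝ[X]} (hf : f.natDegree + 3 ≤ 2 * L)
    {ξ : ℝ} (hξ : ξ ∈ lobattoNodes L) (h0 : ∀ η ∈ lobattoNodes L, η ≠ ξ → f.eval η = 0) :
    lobattoWeight L ξ * f.eval ξ = ∫ x in (0 : ℝ)..1, f.eval x := by
  rw [integral_eval_eq_sum hL hf, Finset.sum_eq_single ξ]
  · intro η hη hne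
    rw [h0 η hη hne, mul_zero]
  · exact fun h => absurd hξ h

lemma lobattoWeight_pos_of_eval {L : ℕ} (hL : 2 ≤ L) {f : ℝ[X]} (hf : f.natDegree + 3 ≤ 2 * L)
    (hf0 : f ≠ 0) (hpos : ∀ x ∈ Set.Icc (0 : ℝ) 1, 0 ≤ f.eval x)
    {ξ : ℝ} (hξ : ξ ∈ lobattoNodes L) (h0 : ∀ η ∈ lobattoNodes L, η ≠ ξ → f.eval η = 0) :
    0 < lobattoWeight L ξ := by
  have h := lobattoWeight_mul_eval hL hf hξ h0
  have hi := integral_eval_pos hf0 hpos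
  rw [← h] at hi
  exact pos_of_mul_pos_left hi (hpos ξ (mem_Icc_of_mem_lobattoNodes hL hξ))

lemma natDegree_endpoint_le {L : ℕ} (hL : 2 ≤ L) {l : ℝ[X]} (hl : l.natDegree = 1) :
    (l * derivative (legendre (L - 1)) ^ 2).natDegree + 3 ≤ 2 * L := by
  have h : (l * derivative (legendre (L - 1)) ^ 2).natDegree ≤ 1 + 2 * (L - 1 - 1) := by
    refine natDegree_mul_le_of_le hl.le (natDegree_pow_le.trans ?_)
    rw [natDegree_derivative_legendre]
  omega

lemma eval_endpoint_zero {L : ℕ} (hL : 2 ≤ L) (η : ℝ) (hη : η ∈ lobattoNodes L) (h : η ≠ 0) :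
    ((1 - X) * derivative (legendre (L - 1)) ^ 2).eval η = 0 := by
  rcases (mem_lobattoNodes hL).1 hη with rfl | rfl | hr
  · exact absurd rfl h
  · simp
  · rw [eval_mul, eval_pow, hr.eq_zero]; simp

lemma eval_endpoint_one {L : ℕ} (hL : 2 ≤ L) (η : ℝ) (hη : η ∈ lobattoNodes L) (h : η ≠ 1) :
    (X * derivative (legendre (L - 1)) ^ 2).eval η = 0 := by
  rcases (mem_lobattoNodes hL).1 hη with rfl | rfl | hr
  · simp
  · exact absurd rfl h
  · rw [eval_mul, eval_pow, hr.eq_zero]; simp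

/-- Each weight is isolated by a nonnegative polynomial vanishing at the other nodes. With P =
`legendre (L - 1)`, these are (1 - X)P'² and XP'² at the ends, of the limiting degree 2L - 3, and
X(1 - X)s² at an interior node ξ, where P' = (X - ξ)s. -/
lemma lobattoWeight_pos {L : ℕ} (hL : 2 ≤ L) {ξ : ℝ} (hξ : ξ ∈ lobattoNodes L) :
    0 < lobattoWeight L ξ := by
  have hn : 1 ≤ L - 1 := by omega
  have hq0 := derivative_legendre_ne_zero hn
  rcases (mem_lobattoNodes hL).1 hξ with rfl | rfl | hr
  · refine lobattoWeight_pos_of_eval hL (natDegree_endpoint_le hL natDegree_one_sub_X)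
      (mul_ne_zero one_sub_X_ne_zero (pow_ne_zero _ hq0)) (fun x hx => ?_) hξ
      (eval_endpoint_zero hL)
    have := sub_nonneg.2 hx.2
    simp only [eval_mul, eval_sub, eval_one, eval_X, eval_pow]
    positivity
  · refine lobattoWeight_pos_of_eval hL (natDegree_endpoint_le hL natDegree_X)
      (mul_ne_zero X_ne_zero (pow_ne_zero _ hq0)) (fun x hx => ?_) hξ
      (eval_endpoint_one hL)
    have := hx.1
    simp only [eval_mul, eval_X, eval_pow]
    positivity
  · obtain ⟨s, hs⟩ := dvd_iff_isRoot.2 hr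
    have hs0 : s ≠ 0 := by rintro rfl; exact hq0 (by simp [hs])
    have hd := natDegree_derivative_legendre (L - 1)
    rw [hs, natDegree_mul (X_sub_C_ne_zero ξ) hs0, natDegree_X_sub_C] at hd
    refine lobattoWeight_pos_of_eval hL (f := X * (1 - X) * s ^ 2) ?_
      (mul_ne_zero (mul_ne_zero X_ne_zero one_sub_X_ne_zero) (pow_ne_zero _ hs0))
      (fun x hx => ?_) hξ fun η hη hne => ?_
    · have : (X * (1 - X) * s ^ 2 : ℝ[X]).natDegree ≤ 1 + 1 + 2 * s.natDegree :=
        natDegree_mul_le_of_le (natDegree_mul_le_of_le natDegree_X_le natDegree_one_sub_X.le)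
          natDegree_pow_le
      omega
    · have h1 := sub_nonneg.2 hx.2
      have h2 := hx.1
      simp only [eval_mul, eval_X, eval_pow, eval_sub, eval_one]
      positivity
    · have h := eval_lobattoPoly_of_mem hL hη
      rw [lobattoPoly, hs] at h
      simp only [eval_mul, eval_X, eval_sub, eval_one, eval_C, mul_eq_zero,
        sub_eq_zero.not.2 hne, false_or, eval_pow] at h ⊢
      rcases h with h | h
      · exact Or.inl h
      · exact Or.inr (by simp [h])

lemma derivative_legendre_eval_one_sub_sq (n : ℕ) (x : ℝ) :
    (derivative (legendre n)).eval (1 - x) ^ 2 = (derivative (legendre n)).eval x ^ 2 := by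
  have h : legendre n = C ((-1) ^ n) * (legendre n).comp (1 - X) := by
    have h := congrArg (Polynomial.map (Int.castRingHom ℝ))
      (neg_one_pow_mul_shiftedLegendre_comp_one_sub_X_eq n)
    simpa [Polynomial.map_comp] using h.symm
  have h' := congrArg (fun f => (derivative f).eval x ^ 2) h
  simp only [derivative_C_mul, derivative_comp, eval_mul, eval_C, eval_comp, eval_sub, eval_one,
    eval_X, derivative_sub, derivative_one, derivative_X, mul_pow, ← pow_mul, zero_sub, eval_neg] at h'
  rw [h', mul_comm n 2, pow_mul]
  norm_num

/-- The reflection x ↦ 1 - x exchanges the two endpoint test polynomials. The CFL bound names only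
the left weight, but the right end needs it too. -/
lemma lobattoWeight_zero_eq_one {L : ℕ} (hL : 2 ≤ L) : lobattoWeight L 0 = lobattoWeight L 1 := by
  have hn : 1 ≤ L - 1 := by omega
  have h0 := lobattoWeight_mul_eval hL (natDegree_endpoint_le hL natDegree_one_sub_X)
    (zero_mem_lobattoNodes hL) (eval_endpoint_zero hL)
  have h1 := lobattoWeight_mul_eval hL (natDegree_endpoint_le hL natDegree_X)
    (one_mem_lobattoNodes hL) (eval_endpoint_one hL)
  have hsub := integral_comp_sub_left (a := 0) (b := 1)
    (fun x => (X * derivative (legendre (L - 1)) ^ 2).eval x) 1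
  simp only [sub_self, sub_zero] at hsub
  rw [← hsub] at h1
  simp only [eval_mul, eval_X, eval_pow, derivative_legendre_eval_one_sub_sq, eval_sub, eval_one,
    sub_zero, one_mul] at h0 h1
  rw [← h1] at h0
  have h2 := derivative_legendre_eval_one_sub_sq (L - 1) 0
  rw [sub_zero] at h2
  rw [h2] at h0
  refine mul_right_cancel₀ (pow_ne_zero 2 fun hz => ?_) h0
  exact lt_irrefl _ (root_derivative_legendre_mem_Ioo hn (a := 0) hz).1

end Quadrature

/-! ### The admissible set as an intersection of half spaces -/

/-- The affine functional `U ↦ U · n + |b|² / 2` with `n = (|a|² / 2, -a, -b, 1)`. -/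
def relEnergy (a b : Fin 3 → ℝ) (U : State) : ℝ :=
  U 0 * (a 0 ^ 2 + a 1 ^ 2 + a 2 ^ 2) / 2 - (U 1 * a 0 + U 2 * a 1 + U 3 * a 2)
    - (U 4 * b 0 + U 5 * b 1 + U 6 * b 2) + U 7 + (b 0 ^ 2 + b 1 ^ 2 + b 2 ^ 2) / 2

lemma relEnergy_eq (a b : Fin 3 → ℝ) {U : State} (hU : U 0 ≠ 0) :
    relEnergy a b U = rho U / 2 * sqNorm (vel U - a) + sqNorm (mag U - b) / 2
      + internalEnergy U := by
  simp [relEnergy, sqNorm, internalEnergy, vel, mom, mag, rho, totalEnergy, Fin.sum_univ_three]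
  field_simp
  ring

lemma sqNorm_nonneg (w : Fin 3 → ℝ) : 0 ≤ sqNorm w :=
  Finset.sum_nonneg fun _ _ => sq_nonneg _

/-- In `relEnergy_eq` the two squares are nonnegative, and they vanish at a = v, b = B. -/
lemma mem_admissibleSet_iff {U : State} :
    U ∈ admissibleSet ↔ 0 < U 0 ∧ ∀ a b, 0 < relEnergy a b U := by
  refine and_congr_right fun h => ⟨fun he a b => ?_, fun h' => ?_⟩
  · rw [relEnergy_eq a b h.ne']
    have := sqNorm_nonneg (vel U - a)
    have := sqNorm_nonneg (mag U - b)
    have := he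
    have := h
    positivity
  · have := h' (vel U) (mag U)
    rw [relEnergy_eq _ _ (ne_of_gt h)] at this
    simpa [sqNorm] using this

lemma convex_admissibleSet : Convex ℝ admissibleSet := by
  intro U hU V hV s t hs ht hst
  rw [mem_admissibleSet_iff] at *
  have key : ∀ x y : ℝ, 0 < x → 0 < y → 0 < s * x + t * y := fun x y hx hy => by
    rcases hs.eq_or_lt with rfl | hs'
    · rw [show t = 1 by linarith]
      linarith
    · have := mul_pos hs' hx
      have := mul_nonneg ht hy.le
      linarith
  refine ⟨by simpa using key _ _ hU.1 hV.1, fun a b => ?_⟩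
  have h := key _ _ (hU.2 a b) (hV.2 a b)
  convert h using 1
  have ht' : t = 1 - s := by linarith
  subst ht'
  simp [relEnergy]
  ring

/-! ### The quadratic form behind `fastLike` -/

/-- Completing squares after multiplication by l(l² - β₁²) leaves the characteristic polynomial as
coefficient of x₁². -/
lemma coupling_le {l c β₁ β₂ β₃ : ℝ} (hl : 0 < l) (hβ : β₁ ^ 2 < l ^ 2)
    (h : 0 ≤ l ^ 4 - (c ^ 2 + (β₁ ^ 2 + β₂ ^ 2 + β₃ ^ 2)) * l ^ 2 + c ^ 2 * β₁ ^ 2)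
    (x₁ x₂ x₃ y₂ y₃ z : ℝ) :
    2 * (c * x₁ * z + x₁ * (β₂ * y₂ + β₃ * y₃) - β₁ * (x₂ * y₂ + x₃ * y₃))
      ≤ l * (x₁ ^ 2 + x₂ ^ 2 + x₃ ^ 2 + y₂ ^ 2 + y₃ ^ 2 + z ^ 2) := by
  have hd : 0 < l ^ 2 - β₁ ^ 2 := sub_pos.2 hβ
  have hld := mul_pos hl hd
  rw [← sub_nonneg]
  refine nonneg_of_mul_nonneg_right ?_ hld
  have e : l * (l ^ 2 - β₁ ^ 2) * (l * (x₁ ^ 2 + x₂ ^ 2 + x₃ ^ 2 + y₂ ^ 2 + y₃ ^ 2 + z ^ 2)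
      - 2 * (c * x₁ * z + x₁ * (β₂ * y₂ + β₃ * y₃) - β₁ * (x₂ * y₂ + x₃ * y₃)))
      = (l ^ 2 - β₁ ^ 2) * ((l * x₂ + β₁ * y₂) ^ 2 + (l * x₃ + β₁ * y₃) ^ 2 + (l * z - c * x₁) ^ 2)
        + ((l ^ 2 - β₁ ^ 2) * y₂ - l * β₂ * x₁) ^ 2 + ((l ^ 2 - β₁ ^ 2) * y₃ - l * β₃ * x₁) ^ 2
        + (l ^ 4 - (c ^ 2 + (β₁ ^ 2 + β₂ ^ 2 + β₃ ^ 2)) * l ^ 2 + c ^ 2 * β₁ ^ 2) * x₁ ^ 2 := by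
    ring
  rw [e]
  positivity

lemma fastLike_nonneg (p : ℝ → ℝ → ℝ) (U : State) : 0 ≤ fastLike p U := by
  unfold fastLike
  positivity

lemma sqNorm_mag (U : State) : sqNorm (mag U) = mag U 0 ^ 2 + mag U 1 ^ 2 + mag U 2 ^ 2 := by
  simp [sqNorm, Fin.sum_univ_three]

/-- A number above `fastLike` lies above the largest root of the characteristic polynomial. -/
lemma char_pos_of_fastLike_lt (p : ℝ → ℝ → ℝ) {U : State} (hU : 0 < rho U) {l : ℝ}
    (hl : fastLike p U < l) :
    mag U 0 ^ 2 / rho U < l ^ 2 ∧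
    0 ≤ l ^ 4 - (soundLike p U ^ 2 + sqNorm (mag U) / rho U) * l ^ 2
      + soundLike p U ^ 2 * (mag U 0 ^ 2 / rho U) := by
  have h0 := fastLike_nonneg p U
  unfold fastLike at hl h0
  have hT : mag U 0 ^ 2 / rho U ≤ sqNorm (mag U) / rho U := by
    gcongr
    rw [sqNorm_mag]
    nlinarith [sq_nonneg (mag U 1), sq_nonneg (mag U 2)]
  have hg0 : 0 ≤ mag U 0 ^ 2 / rho U := by positivity
  have hk0 : 0 ≤ soundLike p U ^ 2 := sq_nonneg _
  rw [mul_div_assoc] at hl h0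
  generalize soundLike p U ^ 2 = k at *
  generalize sqNorm (mag U) / rho U = T at *
  generalize mag U 0 ^ 2 / rho U = g at *
  -- Since g ≤ T, the discriminant is at least (k - g)². So the root is real and r ≥ |k - g|, which
  -- yields g < l².
  have hD : (k - g) ^ 2 ≤ (k + T) ^ 2 - 4 * (k * g) := by nlinarith
  have hDs := Real.abs_le_sqrt hD
  have hDn : 0 ≤ (k + T) ^ 2 - 4 * (k * g) := (sq_nonneg _).trans hD
  have hr0 := Real.sqrt_nonneg ((k + T) ^ 2 - 4 * (k * g))
  have hr2 := Real.sq_sqrt hDn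
  generalize √((k + T) ^ 2 - 4 * (k * g)) = r at *
  have hsq : (1 / √2 * √(k + T + r)) ^ 2 = (k + T + r) / 2 := by
    rw [mul_pow, div_pow, Real.sq_sqrt (by norm_num), Real.sq_sqrt (by linarith)]
    ring
  have hlt : (k + T + r) / 2 < l ^ 2 := by
    rw [← hsq]
    exact pow_lt_pow_left₀ hl h0 two_ne_zero
  have := neg_abs_le (k - g)
  refine ⟨by linarith, ?_⟩
  -- Four times the target is (2l² - (k + T))² - r², and 2l² - (k + T) > r ≥ 0.
  nlinarith [mul_self_nonneg r, mul_nonneg hr0 (by linarith : 0 ≤ 2 * l ^ 2 - (k + T) - r),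
    sq_nonneg (2 * l ^ 2 - (k + T) - r)]

/-- The part of the flux functional that is controlled by `fastLike`. -/
def coupling (p : ℝ → ℝ → ℝ) (U : State) (w d : Fin 3 → ℝ) : ℝ :=
  pressure p U * w 0 + w 0 * (d 1 * mag U 1 + d 2 * mag U 2)
    - mag U 0 * (w 1 * d 1 + w 2 * d 2)

lemma coupling_le_of_fastLike_lt (p : ℝ → ℝ → ℝ) {U : State} (hU : U ∈ admissibleSet) {l : ℝ}
    (hl : fastLike p U < l) (w d : Fin 3 → ℝ) :
    coupling p U w d ≤ l * (rho U / 2 * sqNorm w + sqNorm d / 2 + internalEnergy U) := by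
  have hρ : 0 < rho U := hU.1
  have he : 0 < specificEnergy U := div_pos hU.2 hρ
  obtain ⟨h1, h2⟩ := char_pos_of_fastLike_lt p hρ hl
  have hl0 : 0 < l := (fastLike_nonneg p U).trans_lt hl
  have hE : internalEnergy U = rho U * specificEnergy U := by
    unfold specificEnergy
    field_simp
  have hs0 : 0 < √(rho U) := Real.sqrt_pos.2 hρ
  have ht0 : 0 < √(2 * specificEnergy U) := Real.sqrt_pos.2 (by linarith)
  have hs2 := Real.sq_sqrt hρ.le
  have ht2 := Real.sq_sqrt (by linarith : 0 ≤ 2 * specificEnergy U)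
  have hc : soundLike p U = pressure p U / (√(rho U) ^ 2 * √(2 * specificEnergy U)) := by
    rw [hs2, soundLike]
  generalize √(2 * specificEnergy U) = t at *
  rw [sqNorm_mag] at h2
  have hβ : ∀ i, (mag U i / √(rho U)) ^ 2 = mag U i ^ 2 / rho U := fun i => by rw [div_pow, hs2]
  -- In these scaled variables internal energy is a sixth square, z² = 2ρe, and the pressure term
  -- becomes `soundLike` times x₁z.
  have key := coupling_le (c := soundLike p U) (β₁ := mag U 0 / √(rho U))
    (β₂ := mag U 1 / √(rho U)) (β₃ := mag U 2 / √(rho U)) hl0 (by rwa [hβ])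
    (by rw [hβ, hβ, hβ, ← add_div, ← add_div]; exact h2)
    (√(rho U) * w 0) (√(rho U) * w 1) (√(rho U) * w 2) (d 1) (d 2) (√(rho U) * t)
  have e1 : soundLike p U * (√(rho U) * w 0) * (√(rho U) * t)
      + √(rho U) * w 0 * (mag U 1 / √(rho U) * d 1 + mag U 2 / √(rho U) * d 2)
      - mag U 0 / √(rho U) * (√(rho U) * w 1 * d 1 + √(rho U) * w 2 * d 2)
      = coupling p U w d := by
    rw [hc, coupling]
    field_simp
  rw [e1] at key
  simp only [mul_pow, hs2, ht2] at key
  have hd : 0 ≤ l * d 0 ^ 2 := by positivity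
  rw [hE]
  simp only [sqNorm, Fin.sum_univ_three]
  linarith

/-- Let l decrease to `fastLike`; the other sign follows because the coupling is odd in w. -/
lemma abs_coupling_le (p : ℝ → ℝ → ℝ) {U : State} (hU : U ∈ admissibleSet) (w d : Fin 3 → ℝ) :
    |coupling p U w d|
      ≤ fastLike p U * (rho U / 2 * sqNorm w + sqNorm d / 2 + internalEnergy U) := by
  have hρ : 0 < rho U := hU.1
  have hE : 0 < internalEnergy U := hU.2
  have hw := sqNorm_nonneg w
  have hd := sqNorm_nonneg d
  have hQ : 0 < rho U / 2 * sqNorm w + sqNorm d / 2 + internalEnergy U := by positivity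
  rw [← div_le_iff₀ hQ]
  refine le_of_forall_gt_imp_ge_of_dense fun l hl => ?_
  rw [div_le_iff₀ hQ, abs_le']
  refine ⟨coupling_le_of_fastLike_lt p hU hl w d, ?_⟩
  have h := coupling_le_of_fastLike_lt p hU hl (-w) d
  have e1 : coupling p U (-w) d = -coupling p U w d := by simp [coupling]; ring
  have e2 : sqNorm (-w) = sqNorm w := by simp [sqNorm]
  rwa [e1, e2] at h

/-! ### The generalized Lax–Friedrichs splitting property -/

/-- The value of the flux under the linear part of `relEnergy a b`. -/
lemma relEnergy_flux (p : ℝ → ℝ → ℝ) (a b : Fin 3 → ℝ) {U : State} (hU : U 0 ≠ 0) :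
    relEnergy a b (flux p U) - (b 0 ^ 2 + b 1 ^ 2 + b 2 ^ 2) / 2
      = vel U 0 * (rho U / 2 * sqNorm (vel U - a) + internalEnergy U)
        + a 0 * sqNorm (mag U - b) / 2 + coupling p U (vel U - a) (mag U - b)
        + (mag U 0 * (a 0 * b 0 + a 1 * b 1 + a 2 * b 2)
          - a 0 * (b 0 ^ 2 + b 1 ^ 2 + b 2 ^ 2) / 2) := by
  simp [relEnergy, flux, totalPressure, coupling, sqNorm, internalEnergy, vel, mom, mag, rho,
    totalEnergy, Fin.sum_univ_three]
  field_simp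
  ring

lemma magJump_nonneg (U V : State) (σ : ℝ) : 0 ≤ magJump U V σ := by
  unfold magJump
  positivity

/-- Cauchy–Schwarz with weights ρ bounds the velocity factor. The magnetic factor is a difference of
squares, (B_U - B_V)·(B_U + B_V - 2b), bounded by Cauchy–Schwarz again. -/
lemma abs_cross_le {U V : State} (hU : 0 < rho U) (hV : 0 < rho V) (σ : ℝ) (a b : Fin 3 → ℝ) :
    |(σ * (vel U 0 - a 0) + (1 - σ) * (vel V 0 - a 0)) * (sqNorm (mag U - b) - sqNorm (mag V - b))|
      ≤ magJump U V σ * (rho U * sqNorm (vel U - a) + rho V * sqNorm (vel V - a)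
        + sqNorm (mag U - b) + sqNorm (mag V - b)) := by
  have hJ := magJump_nonneg U V σ
  have hX : 0 ≤ rho U * (vel U 0 - a 0) ^ 2 + rho V * (vel V 0 - a 0) ^ 2 := by positivity
  have hY : 0 ≤ sqNorm (mag U - b) + sqNorm (mag V - b) :=
    add_nonneg (sqNorm_nonneg _) (sqNorm_nonneg _)
  have h1 : rho U * (vel U 0 - a 0) ^ 2 ≤ rho U * sqNorm (vel U - a) := by
    gcongr
    simp only [sqNorm, Fin.sum_univ_three, Pi.sub_apply]
    linarith [sq_nonneg (vel U 1 - a 1), sq_nonneg (vel U 2 - a 2)]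
  have h2 : rho V * (vel V 0 - a 0) ^ 2 ≤ rho V * sqNorm (vel V - a) := by
    gcongr
    simp only [sqNorm, Fin.sum_univ_three, Pi.sub_apply]
    linarith [sq_nonneg (vel V 1 - a 1), sq_nonneg (vel V 2 - a 2)]
  have hcs : (σ * (vel U 0 - a 0) + (1 - σ) * (vel V 0 - a 0)) ^ 2
      ≤ (σ ^ 2 / rho U + (1 - σ) ^ 2 / rho V)
        * (rho U * (vel U 0 - a 0) ^ 2 + rho V * (vel V 0 - a 0) ^ 2) := by
    rw [← sub_nonneg]
    have e : (σ ^ 2 / rho U + (1 - σ) ^ 2 / rho V)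
        * (rho U * (vel U 0 - a 0) ^ 2 + rho V * (vel V 0 - a 0) ^ 2)
        - (σ * (vel U 0 - a 0) + (1 - σ) * (vel V 0 - a 0)) ^ 2
        = (σ * rho V * (vel V 0 - a 0) - (1 - σ) * rho U * (vel U 0 - a 0)) ^ 2
          / (rho U * rho V) := by
      field_simp
      ring
    rw [e]
    positivity
  have hB : (sqNorm (mag U - b) - sqNorm (mag V - b)) ^ 2
      ≤ sqNorm (mag V - mag U) * (2 * (sqNorm (mag U - b) + sqNorm (mag V - b))) := by
    have e : sqNorm (mag U - b) - sqNorm (mag V - b)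
        = ∑ i, (mag V - mag U) i * (-((mag U - b) i + (mag V - b) i)) := by
      rw [sqNorm, sqNorm, ← Finset.sum_sub_distrib]
      refine Finset.sum_congr rfl fun i _ => ?_
      simp only [Pi.sub_apply]
      ring
    rw [e]
    refine (Finset.sum_mul_sq_le_sq_mul_sq _ _ _).trans ?_
    refine mul_le_mul_of_nonneg_left ?_ (sqNorm_nonneg _)
    rw [sqNorm, sqNorm, ← Finset.sum_add_distrib, Finset.mul_sum]
    refine Finset.sum_le_sum fun i _ => ?_
    linarith [sq_nonneg ((mag U - b) i - (mag V - b) i)]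
  have hJ2 : magJump U V σ ^ 2
      = sqNorm (mag V - mag U) / 2 * (σ ^ 2 / rho U + (1 - σ) ^ 2 / rho V) := by
    rw [magJump, mul_pow, div_pow, Real.sq_sqrt (sqNorm_nonneg _), Real.sq_sqrt (by norm_num),
      Real.sq_sqrt (by positivity)]
  have hle : magJump U V σ * (rho U * (vel U 0 - a 0) ^ 2 + rho V * (vel V 0 - a 0) ^ 2
        + (sqNorm (mag U - b) + sqNorm (mag V - b)))
      ≤ magJump U V σ * (rho U * sqNorm (vel U - a) + rho V * sqNorm (vel V - a)
        + sqNorm (mag U - b) + sqNorm (mag V - b)) :=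
    mul_le_mul_of_nonneg_left (by linarith) hJ
  refine (abs_le_of_sq_le_sq ?_ (mul_nonneg hJ (add_nonneg hX hY))).trans hle
  have hS : 0 ≤ (σ ^ 2 / rho U + (1 - σ) ^ 2 / rho V) := by positivity
  rw [mul_pow, mul_pow, hJ2]
  refine (mul_le_mul hcs hB (sq_nonneg _) (mul_nonneg hS hX)).trans ?_
  have hZ := mul_nonneg (sqNorm_nonneg (mag V - mag U)) hS
  generalize rho U * (vel U 0 - a 0) ^ 2 + rho V * (vel V 0 - a 0) ^ 2 = x at *
  generalize sqNorm (mag U - b) + sqNorm (mag V - b) = y at *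
  generalize σ ^ 2 / rho U + (1 - σ) ^ 2 / rho V = s at *
  generalize sqNorm (mag V - mag U) = z at *
  -- AM–GM in the form 4xy ≤ (x + y)².
  linarith [mul_nonneg hZ (sq_nonneg (x - y))]

/-- The averaged state of the Lax–Friedrichs splitting. -/
def lfAverage (p : ℝ → ℝ → ℝ) (α : ℝ) (U V : State) : State :=
  (1 / 2 : ℝ) • (U - α⁻¹ • flux p U + (V + α⁻¹ • flux p V))

/-- Write a₁ = (σv₁ + (1-σ)ṽ₁) - (σ(v₁-a₁) + (1-σ)(ṽ₁-a₁)). The first part is absorbed by the third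
entry of the maximum in `alphaAt`, the second by `magJump`. -/
lemma lf_dissipation_pos (p : ℝ → ℝ → ℝ) {U V : State} (hU : U ∈ admissibleSet)
    (hV : V ∈ admissibleSet) (hB : mag U 0 = mag V 0) {α σ : ℝ} (hα : alphaAt p U V σ < α)
    (a b : Fin 3 → ℝ) :
    0 < α * (relEnergy a b U + relEnergy a b V)
      - relEnergy a b (flux p U) + relEnergy a b (flux p V) := by
  have hρU : 0 < rho U := hU.1
  have hρV : 0 < rho V := hV.1
  have hEU : 0 < internalEnergy U := hU.2
  have hEV : 0 < internalEnergy V := hV.2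
  have hFU := relEnergy_flux p a b (U := U) (ne_of_gt hρU)
  have hFV := relEnergy_flux p a b (U := V) (ne_of_gt hρV)
  -- With a common B₁ the last brackets of `hFU` and `hFV` coincide and cancel in the difference.
  rw [← hB] at hFV
  have hcU := abs_le.1 (abs_coupling_le p hU (vel U - a) (mag U - b))
  have hcV := abs_le.1 (abs_coupling_le p hV (vel V - a) (mag V - b))
  have hx := abs_le.1 (abs_cross_le hρU hρV σ a b)
  rw [relEnergy_eq a b (ne_of_gt hρU), relEnergy_eq a b (ne_of_gt hρV)]
  have hnU := sqNorm_nonneg (mag U - b)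
  have hnV := sqNorm_nonneg (mag V - b)
  have hkU := mul_nonneg (half_pos hρU).le (sqNorm_nonneg (vel U - a))
  have hkV := mul_nonneg (half_pos hρV).le (sqNorm_nonneg (vel V - a))
  unfold alphaAt at hα
  set A := max (max (|vel U 0| + fastLike p U) (|vel V 0| + fastLike p V))
      (|σ * vel U 0 + (1 - σ) * vel V 0| + max (fastLike p U) (fastLike p V)) with hA
  have hA1 : |vel U 0| ≤ A - fastLike p U :=
    le_sub_iff_add_le.2 ((le_max_left _ _).trans (le_max_left _ _))
  have hA2 : |vel V 0| ≤ A - fastLike p V :=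
    le_sub_iff_add_le.2 ((le_max_right _ _).trans (le_max_left _ _))
  have hA3 : |σ * vel U 0 + (1 - σ) * vel V 0| ≤ A - max (fastLike p U) (fastLike p V) :=
    le_sub_iff_add_le.2 (le_max_right _ _)
  have hA4 := hA3.trans (sub_le_sub_left (le_max_left _ _) _)
  have hA5 := hA3.trans (sub_le_sub_left (le_max_right _ _) _)
  have b1 := mul_le_mul_of_nonneg_right ((le_abs_self _).trans hA1) (add_nonneg hkU hEU.le)
  have b2 := mul_le_mul_of_nonneg_right ((neg_le_abs _).trans hA2) (add_nonneg hkV hEV.le)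
  have b3 := mul_le_mul_of_nonneg_right ((le_abs_self _).trans hA4) hnU
  have b4 := mul_le_mul_of_nonneg_right ((neg_le_abs _).trans hA5) hnV
  have hpos := mul_pos (sub_pos.2 hα)
    (by positivity : 0 < rho U / 2 * sqNorm (vel U - a) + sqNorm (mag U - b) / 2
      + internalEnergy U + (rho V / 2 * sqNorm (vel V - a) + sqNorm (mag V - b) / 2
      + internalEnergy V))
  have hJE := mul_nonneg (magJump_nonneg U V σ) (add_nonneg hEU.le hEV.le)
  linarith [hcU.2, hcV.1, hx.1]

lemma alphaAt_nonneg (p : ℝ → ℝ → ℝ) (U V : State) (σ : ℝ) : 0 ≤ alphaAt p U V σ := by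
  refine add_nonneg (le_trans ?_ ((le_max_left _ _).trans (le_max_left _ _))) (magJump_nonneg _ _ _)
  exact add_nonneg (abs_nonneg _) (fastLike_nonneg _ _)

/-- Generalized Lax–Friedrichs splitting property in one space dimension. -/
lemma lfAverage_mem (p : ℝ → ℝ → ℝ) {U V : State} (hU : U ∈ admissibleSet)
    (hV : V ∈ admissibleSet) (hB : mag U 0 = mag V 0) {α : ℝ} (hα : alphaOne p U V < α) :
    0 < α ∧ lfAverage p α U V ∈ admissibleSet := by
  -- The strict inequality supplies a σ, so the minimum need not be attained.
  obtain ⟨σ, hσ⟩ := exists_lt_of_ciInf_lt hα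
  have hα0 : 0 < α := (alphaAt_nonneg p U V σ).trans_lt hσ
  refine ⟨hα0, mem_admissibleSet_iff.2 ⟨?_, fun a b => ?_⟩⟩
  · have h0 := magJump_nonneg U V σ
    have hmax : max (|vel U 0| + fastLike p U) (|vel V 0| + fastLike p V) < α := by
      refine lt_of_le_of_lt ?_ hσ
      exact (le_max_left _ _).trans (le_add_of_nonneg_right h0)
    obtain ⟨h1, h2⟩ := max_lt_iff.1 hmax
    have h3 : vel U 0 < α := by linarith [le_abs_self (vel U 0), fastLike_nonneg p U]
    have h4 : -vel V 0 < α := by linarith [neg_le_abs (vel V 0), fastLike_nonneg p V]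
    have hρU : 0 < U 0 := hU.1
    have hρV : 0 < V 0 := hV.1
    have e : lfAverage p α U V 0
        = (1 / 2) * α⁻¹ * (U 0 * (α - vel U 0) + V 0 * (α + vel V 0)) := by
      simp [lfAverage, flux, rho, Matrix.vecHead]
      field_simp
    rw [e]
    have := mul_pos hρU (sub_pos.2 h3)
    have := mul_pos hρV (by linarith : 0 < α + vel V 0)
    positivity
  · have h := lf_dissipation_pos p hU hV hB hσ a b
    have e : relEnergy a b (lfAverage p α U V)
        = (1 / 2) * α⁻¹ * (α * (relEnergy a b U + relEnergy a b V)
      - relEnergy a b (flux p U) + relEnergy a b (flux p V)) := by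
      simp only [relEnergy, lfAverage, Pi.smul_apply, Pi.add_apply, Pi.sub_apply, smul_eq_mul]
      field_simp
      ring
    rw [e]
    positivity

/-! ### Convex decomposition of the scheme -/

lemma cellAverage_eq_sum {K L : ℕ} (hL2 : 2 ≤ L) (hL : K + 3 ≤ 2 * L) {x₀ dx : ℝ} (hdx : 0 < dx)
    (j : ℤ) {P : PolyState} (hdeg : ∀ i, (P i).natDegree ≤ K) :
    cellAverage x₀ dx j P
      = ∑ ξ ∈ lobattoNodes L, lobattoWeight L ξ • P.at (face x₀ dx j + dx * ξ) := by
  ext i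
  rw [Finset.sum_apply]
  simp only [Pi.smul_apply, smul_eq_mul, cellAverage, PolyState.at]
  have hq : ((P i).comp (Polynomial.C (face x₀ dx j) + Polynomial.C dx * Polynomial.X)).natDegree
      ≤ K := by
    refine Polynomial.natDegree_comp_le.trans ?_
    have h1 : (Polynomial.C (face x₀ dx j) + Polynomial.C dx * Polynomial.X : ℝ[X]).natDegree
        ≤ 1 := by
      rw [add_comm]
      exact Polynomial.natDegree_linear_le
    exact (Nat.mul_le_mul (hdeg i) h1).trans (by omega)
  have h := integral_eval_eq_sum hL2 (by omega : _ + 3 ≤ 2 * L)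
    (f := (P i).comp (Polynomial.C (face x₀ dx j) + Polynomial.C dx * Polynomial.X))
  simp only [Polynomial.eval_comp, Polynomial.eval_add, Polynomial.eval_C, Polynomial.eval_mul,
    Polynomial.eval_X] at h
  rw [← h, intervalIntegral.integral_comp_add_mul (fun x => (P i).eval x) hdx.ne', smul_eq_mul,
    one_div]
  have hf : face x₀ dx j + dx * 1 = face x₀ dx (j + 1) := by
    simp only [face]
    push_cast
    ring
  rw [hf, mul_zero, add_zero]

lemma schemeUpdate_eq (p : ℝ → ℝ → ℝ) (x₀ dx dt : ℝ) {α : ℝ} (hα : α ≠ 0) (Ubar : ℤ → State)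
    (P : ℤ → PolyState) (j : ℤ) :
    schemeUpdate p x₀ dx dt α Ubar P j = Ubar j
      + (α * dt / dx) •
        (lfAverage p α (tracePlus x₀ dx P j) (tracePlus x₀ dx P (j - 1))
          - tracePlus x₀ dx P (j - 1))
      + (α * dt / dx) •
        (lfAverage p α (traceMinus x₀ dx P j) (traceMinus x₀ dx P (j - 1))
          - traceMinus x₀ dx P j) := by
  ext i
  simp only [schemeUpdate, lfFlux, lfAverage, Pi.add_apply, Pi.sub_apply, Pi.smul_apply,
    smul_eq_mul]
  field_simp
  ring

lemma add_smul_sub_mem {U V : State} (hU : U ∈ admissibleSet) (hV : V ∈ admissibleSet) {t : ℝ}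
    (ht0 : 0 ≤ t) (ht1 : t ≤ 1) : U + t • (V - U) ∈ admissibleSet :=
  convex_admissibleSet.add_smul_sub_mem hU hV ⟨ht0, ht1⟩

theorem schemeUpdate_mem (p : ℝ → ℝ → ℝ) {K L : ℕ} (hL2 : 2 ≤ L) (hL : K + 3 ≤ 2 * L)
    {x₀ dx Bconst : ℝ} (hdx : 0 < dx) {P : ℤ → PolyState}
    (hdeg : ∀ j i, (P j i).natDegree ≤ K) {α dt : ℝ}
    (h : LevelConditions p L x₀ dx Bconst P α dt) (j : ℤ) :
    schemeUpdate p x₀ dx dt α (fun j => cellAverage x₀ dx j (P j)) P j ∈ admissibleSet := by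
  have hface : ∀ k : ℤ, face x₀ dx k + dx * 1 = face x₀ dx (k + 1) := fun k => by
    simp only [face]
    push_cast
    ring
  have hmem0 := zero_mem_lobattoNodes hL2
  have hmem1 := one_mem_lobattoNodes hL2
  have hminus : ∀ k, traceMinus x₀ dx P k ∈ admissibleSet := fun k => by
    rw [traceMinus, ← hface]
    exact h.nodes_admissible k 1 hmem1
  have hplus : ∀ k, tracePlus x₀ dx P k ∈ admissibleSet := fun k => by
    have := h.nodes_admissible (k + 1) 0 hmem0
    rwa [mul_zero, add_zero] at this
  obtain ⟨hα0, hΞm⟩ := lfAverage_mem p (hminus j) (hminus (j - 1))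
    ((h.mag_const j).1.trans (h.mag_const (j - 1)).1.symm) (h.viscosity j).1
  obtain ⟨-, hΞp⟩ := lfAverage_mem p (hplus j) (hplus (j - 1))
    ((h.mag_const j).2.trans (h.mag_const (j - 1)).2.symm) (h.viscosity j).2
  rw [schemeUpdate_eq p x₀ dx dt hα0.ne', cellAverage_eq_sum hL2 hL hdx j (hdeg j)]
  have hw0 := lobattoWeight_pos hL2 hmem0
  have hw1 := lobattoWeight_zero_eq_one hL2
  obtain ⟨hc0, hc1⟩ := h.cfl
  set c := α * dt / dx
  set Ξp := lfAverage p α (tracePlus x₀ dx P j) (tracePlus x₀ dx P (j - 1))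
  set Ξm := lfAverage p α (traceMinus x₀ dx P j) (traceMinus x₀ dx P (j - 1))
  have ht0 : 0 ≤ c / lobattoWeight L 0 := by positivity
  have ht1 : c / lobattoWeight L 0 ≤ 1 := (div_le_one hw0).2 hc1
  have hU0 : (P j).at (face x₀ dx j + dx * 0) = tracePlus x₀ dx P (j - 1) := by
    rw [tracePlus, sub_add_cancel, mul_zero, add_zero]
  have hU1 : (P j).at (face x₀ dx j + dx * 1) = traceMinus x₀ dx P j := by
    rw [traceMinus, hface]
  -- Corrections are divided by the weight and placed at the end nodes; each end value then moves a
  -- fraction c/ω̂₁ ≤ 1 of the way to Ξ⁺ or Ξ⁻.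
  let D : ℝ → State := fun ξ =>
    if ξ = 0 then (c / lobattoWeight L 0) • (Ξp - tracePlus x₀ dx P (j - 1))
    else if ξ = 1 then (c / lobattoWeight L 0) • (Ξm - traceMinus x₀ dx P j) else 0
  have hD : ∑ ξ ∈ lobattoNodes L, lobattoWeight L ξ • D ξ
      = c • (Ξp - tracePlus x₀ dx P (j - 1)) + c • (Ξm - traceMinus x₀ dx P j) := by
    rw [Finset.sum_eq_add_of_mem 0 1 hmem0 hmem1 zero_ne_one]
    · simp only [D, if_true, one_ne_zero, if_false, ← hw1, smul_smul]
      rw [mul_div_cancel₀ _ hw0.ne']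
    · intro ξ _ hξ
      simp only [D, if_neg hξ.1, if_neg hξ.2, smul_zero]
  rw [add_assoc, ← hD, ← Finset.sum_add_distrib]
  simp only [← smul_add]
  refine convex_admissibleSet.sum_mem (fun ξ hξ => (lobattoWeight_pos hL2 hξ).le)
    (sum_lobattoWeight hL2) fun ξ hξ => ?_
  by_cases h0 : ξ = 0
  · subst h0
    simp only [D, if_true, hU0]
    exact add_smul_sub_mem (hplus _) hΞp ht0 ht1
  · by_cases h1 : ξ = 1
    · subst h1
      simp only [D, if_true, if_neg h0, hU1]
      exact add_smul_sub_mem (hminus _) hΞm ht0 ht1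
    · simp only [D, if_neg h0, if_neg h1, add_zero]
      exact h.nodes_admissible j ξ hξ

end MHD

end

theorem theorem3p4
    (p : ℝ → ℝ → ℝ) (hp : MHD.IsEOS p)
    (K L : ℕ) (hK : 1 ≤ K) (hL : K + 3 ≤ 2 * L)
    (x₀ dx : ℝ) (hdx : 0 < dx) (Bconst : ℝ)
    (α dt : ℕ → ℝ)
    (Ubar : ℕ → ℤ → MHD.State) (P : ℕ → ℤ → MHD.PolyState)
    (hdeg : ∀ n j i, (P n j i).natDegree ≤ K)
    (havg : ∀ n j, MHD.cellAverage x₀ dx j (P n j) = Ubar n j)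
    (hscheme : ∀ n j,
      Ubar (n + 1) j = MHD.schemeUpdate p x₀ dx (dt n) (α n) (Ubar n) (P n) j) :
    (∀ n, MHD.LevelConditions p L x₀ dx Bconst (P n) (α n) (dt n) →
      ∀ j, Ubar (n + 1) j ∈ MHD.admissibleSet) ∧
    ((∀ j, Ubar 0 j ∈ MHD.admissibleSet) →
      ∀ N, (∀ n < N, MHD.LevelConditions p L x₀ dx Bconst (P n) (α n) (dt n)) →
        ∀ n ≤ N, ∀ j, Ubar n j ∈ MHD.admissibleSet) := by
  have step : ∀ n, MHD.LevelConditions p L x₀ dx Bconst (P n) (α n) (dt n) →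
      ∀ j, Ubar (n + 1) j ∈ MHD.admissibleSet := fun n h j => by
    rw [hscheme, ← funext (havg n)]
    exact MHD.schemeUpdate_mem p (by omega) hL hdx (hdeg n) h j
  refine ⟨step, fun h0 N hN n hn j => ?_⟩
  -- No induction is needed: the conditions at one level alone give the next.
  cases n with
  | zero => exact h0 j
  | succ n => exact step n (hN n hn) j
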